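/- Let $n\ge 1$ and let $(a_{rs})_{1\le r,s\le n}$ be a Cartan matrix of finite type, with directed Dynkin diagram on the vertices $1,\dots,n$ (in any order): $r,s$ are joined by a single edge if $a_{rs}=a_{sr}=-1$, and by a double (triple) edge with an arrow from $r$ to $s$ if $a_{rs}=-2$ ($a_{rs}=-3$), in which case $a_{sr}=-1$. Let $W$ be its Weyl group, with simple reflections $\sigma_1,\dots,\sigma_n$. Let $\Bbbk$ be a field. Assume that every vertex $s$ can be reached from the vertex $1$ by a path $1=r_0,r_1,\dots,r_m=s$ with $a_{r_{j-1}r_j}\neq 0$ in $\Bbbk$ for all $j$; that is, the diagram is connected and, if $\operatorname{char}\Bbbk=2$ (resp. $3$), no double (resp. triple) arrow points away from the vertex $1$. Let $e\ge 0$, $e\ne 1$, $I=\mathbb Z/e\mathbb Z$, let $W$ act on $I^n$ by $\sigma_r(\mathbf i)_s=i_s-a_{sr}i_r$, let $\mathcal C\subset I^n$ be a $W$-orbit, and let $\Lambda=(\Lambda_i)_{i\in I}$ be a finitely supported family of natural numbers. Put $\sigma_r(y_s)=y_s-a_{sr}y_r$ and $\delta_{i_r}^0=1$ if $i_r=0$,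 $\delta_{i_r}^0=0$ otherwise. Let $\mathcal R$ be the unital $\Bbbk$-algebra generated by $y_1,\dots,y_n,\psi_1,\dots,\psi_n$ and $\epsilon(\mathbf i)$, $\mathbf i\in\mathcal C$, subject to the following relations for all $r,s$ and all $\mathbf i,\mathbf j\in\mathcal C$. 1. $\epsilon(\mathbf i)\epsilon(\mathbf j)=\delta_{\mathbf i\mathbf j}\epsilon(\mathbf i)$, $\sum_{\mathbf i\in\mathcal C}\epsilon(\mathbf i)=1$. 2. $y_r\epsilon(\mathbf i)=\epsilon(\mathbf i)y_r$, $y_ry_s=y_sy_r$. 3. $\psi_r\epsilon(\mathbf i)=\epsilon(\sigma_r(\mathbf i))\psi_r$. 4. $\psi_ry_s\epsilon(\mathbf i)=(\sigma_r(y_s)\psi_r-\delta_{i_r}^0a_{sr})\epsilon(\mathbf i)$. 5. $\psi_r^2\epsilon(\mathbf i)=q\,\epsilon(\mathbf i)$, with $q=0$ if $i_r=0$; $-y_r$ if $i_r=1,e\ne2$; $y_r$ if $i_r=-1,e\neq 2$; $-y_r^2$ if $i_r=1,e=2$; $1$ if $i_r\ne0,\pm1$. 6. $\psi_r\psi_s=\psi_s\psi_r$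 if $a_{rs}=0$. 7. If $r,s$ are joined by a single edge: $(\psi_r\psi_s\psi_r-\psi_s\psi_r\psi_s)\epsilon(\mathbf i)=b\,\epsilon(\mathbf i)$, with $b=1$ if $i_r=-i_s=1,e\ne2$; $-1$ if $i_r=-i_s=-1,e\ne2$; $y_r-y_s$ if $i_r=i_s=1,e=2$; $0$ otherwise. 8. If there is a double arrow from $r$ to $s$: $((\psi_r\psi_s)^2-(\psi_s\psi_r)^2)\epsilon(\mathbf i)=b\,\epsilon(\mathbf i)$, with $b=-\psi_r$ if $i_s=1,i_r=-2,e\ne2$; $\psi_r$ if $i_s=-1,i_r=2,e\ne2$; $y_r\psi_r+1$ if $i_r=0,i_s=1,e=2$; $2\psi_s$ if $i_r=-i_s=1,e\ne2$; $-2\psi_s$ if $i_r=-i_s=-1,e\ne2$; $-4y_s\psi_s$ if $i_r=i_s=1,e=2$; $0$ otherwise. 9. If there is a triple arrow from $r$ to $s$: $((\psi_r\psi_s)^3-(\psi_s\psi_r)^3)\epsilon(\mathbf i)=b\,\epsilon(\mathbf i)$, where, with $y_{s1}=\sigma_r(y_s)$ and $y_{r1}=\sigma_s(y_r)$, $b$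 is given by the first row of the following list whose condition holds: $-\psi_r\psi_s\psi_r$ if $i_s=1,i_r=-3,e\ne2,3$; $\psi_r\psi_s\psi_r$ if $i_s=-1,i_r=3,e\neq2,3$; $3\psi_s\psi_r\psi_s$ if $i_r=-i_s=1,e\ne2$; $-3\psi_s\psi_r\psi_s$ if $i_r=-i_s=-1,e\ne2$; $-2y_r\psi_r$ if $i_s=\pm1,i_r=\mp2,e\ne2$; $-4(y_r^2+3y_sy_{s1})(y_r\psi_r+1)$ if $i_r=0,i_s=1,e=2$; $-2y_s\psi_s$ if $i_r=\pm1,i_s=2,e=4$; $\psi_s$ if $i_r=1,i_s\ne-2,e\ne2$; $-\psi_s$ if $i_r=-1,i_s\neq-2,e\ne2$; $\psi_s$ if $i_r=3,i_s=-2,e\ne2,3$; $-\psi_s$ if $i_r=-3,i_s=2,e\ne2,3$; $4(y_r^2+3y_sy_{s1})(y_s\psi_s+1)$ if $i_r=1,i_s=0,e=2$; $y_{s1}\psi_r\psi_s\psi_r-3y_{r1}\psi_s\psi_r\psi_s-y_r^2+3y_s^2$ if $i_r=i_s=1,e=2$; $-\psi_r\psi_s\psi_r$ if $i_r=0,i_s=1,e=3$;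 $\psi_r\psi_s\psi_r$ if $i_r=0,i_s=-1,e=3$; $0$ otherwise. Let the BK subalgebra $\tilde{\mathcal L}$ be the unital $\Bbbk$-algebra generated by the same generators and by elements $f^{-1}$ for all $f\in\Bbbk[y_1,\dots,y_n]$ with $f(0)\ne0$, subject to the relations 1–9 and $ff^{-1}=f^{-1}f=1$ for all such $f$. Let $\mathcal R(\Lambda)$ and $\tilde{\mathcal L}(\Lambda)$ be the quotients of $\mathcal R$ and $\tilde{\mathcal L}$ by the two-sided ideals generated by the elements $y_1^{\Lambda_{i_1}}\epsilon(\mathbf i)$, $\mathbf i\in\mathcal C$. Then there is a $\Bbbk$-algebra isomorphism $\mathcal R(\Lambda)\cong\tilde{\mathcal L}(\Lambda)$ that sends the classes of $y_r,\psi_r,\epsilon(\mathbf i)$ to the classes of the same-named elements. -/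

import Mathlib

/-- A Cartan matrix of finite type with rows and columns indexed by the vertices `Fin n` of its
(directed) Dynkin diagram; vertex number 1 is `0 : Fin n`. -/
structure FiniteCartanMatrix (n : ℕ) where
  a : Matrix (Fin n) (Fin n) ℤ
  diag : ∀ r, a r r = 2
  nonpos : ∀ r s, r ≠ s → a r s ≤ 0
  zero_symm : ∀ r s, a r s = 0 → a s r = 0
  posDef : ∃ d : Fin n → ℝ, (∀ r, 0 < d r) ∧
    (Matrix.diagonal d * a.map (Int.cast : ℤ → ℝ)).PosDef

namespace FiniteCartanMatrix

variable {n : ℕ}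

theorem reflection_involutive (A : FiniteCartanMatrix n) (e : ℕ) (r : Fin n) :
    Function.Involutive
      (fun (i : Fin n → ZMod e) (s : Fin n) => i s - (A.a s r : ZMod e) * i r) := by
  intro i
  funext s
  have h : (A.a r r : ZMod e) = 2 := by rw [A.diag r]; norm_num
  simp only [h]
  ring

/-- The action of the simple reflection `σ_r` on `I ^ n`, where `I = ℤ / e ℤ`:
`σ_r(i)_s = i_s - a_{sr} i_r`. -/
def reflection (A : FiniteCartanMatrix n) (e : ℕ) (r : Fin n) :
    Equiv.Perm (Fin n → ZMod e) :=
  (A.reflection_involutive e r).toPerm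

/-- The Weyl group in its action on `I ^ n`: the group of permutations generated by the simple
reflections. Its orbits are the orbits of the Weyl group. -/
def weylGroup (A : FiniteCartanMatrix n) (e : ℕ) : Subgroup (Equiv.Perm (Fin n → ZMod e)) :=
  Subgroup.closure (Set.range (A.reflection e))

end FiniteCartanMatrix

namespace KLRType

variable {n e : ℕ}

section Relations

variable {B : Type*} [Ring B]

/-- The element `q` with `ψ_r ^ 2 ε(i) = q ε(i)`, in terms of `i_r` and `y_r`. -/
def squareTerm (ir : ZMod e) (yr : B) : B :=
  if ir = 0 then 0
  else if ir = 1 ∧ e ≠ 2 then -yr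
  else if ir = -1 ∧ e ≠ 2 then yr
  else if ir = 1 ∧ e = 2 then -yr ^ 2
  else 1

/-- The correction of the braid relation of length 3 (single edge between `r` and `s`). -/
def braidTerm3 (ir js : ZMod e) (yr ys : B) : B :=
  if ir = 1 ∧ js = -1 ∧ e ≠ 2 then 1
  else if ir = -1 ∧ js = 1 ∧ e ≠ 2 then -1
  else if ir = 1 ∧ js = 1 ∧ e = 2 then yr - ys
  else 0

/-- The correction of the braid relation of length 4 (double edge with arrow from `r` to `s`). -/
def braidTerm4 (ir js : ZMod e) (yr ys ψr ψs : B) : B :=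
  if js = 1 ∧ ir = -2 ∧ e ≠ 2 then -ψr
  else if js = -1 ∧ ir = 2 ∧ e ≠ 2 then ψr
  else if ir = 0 ∧ js = 1 ∧ e = 2 then yr * ψr + 1
  else if ir = 1 ∧ js = -1 ∧ e ≠ 2 then 2 * ψs
  else if ir = -1 ∧ js = 1 ∧ e ≠ 2 then -2 * ψs
  else if ir = 1 ∧ js = 1 ∧ e = 2 then -4 * ys * ψs
  else 0

/-- The correction of the braid relation of length 6 (triple edge with arrow from `r` to `s`).
Here `yr1` and `ys1` stand for `σ_s(y_r)` and `σ_r(y_s)`. The rows are read in order. -/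
def braidTerm6 (ir js : ZMod e) (yr ys yr1 ys1 ψr ψs : B) : B :=
  if js = 1 ∧ ir = -3 ∧ e ≠ 2 ∧ e ≠ 3 then -(ψr * ψs * ψr)
  else if js = -1 ∧ ir = 3 ∧ e ≠ 2 ∧ e ≠ 3 then ψr * ψs * ψr
  else if ir = 1 ∧ js = -1 ∧ e ≠ 2 then 3 * (ψs * ψr * ψs)
  else if ir = -1 ∧ js = 1 ∧ e ≠ 2 then -3 * (ψs * ψr * ψs)
  else if ((js = 1 ∧ ir = -2) ∨ (js = -1 ∧ ir = 2)) ∧ e ≠ 2 then -2 * yr * ψr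
  else if ir = 0 ∧ js = 1 ∧ e = 2 then -4 * (yr ^ 2 + 3 * ys * ys1) * (yr * ψr + 1)
  else if (ir = 1 ∨ ir = -1) ∧ js = 2 ∧ e = 4 then -2 * ys * ψs
  else if ir = 1 ∧ js ≠ -2 ∧ e ≠ 2 then ψs
  else if ir = -1 ∧ js ≠ -2 ∧ e ≠ 2 then -ψs
  else if ir = 3 ∧ js = -2 ∧ e ≠ 2 ∧ e ≠ 3 then ψs
  else if ir = -3 ∧ js = 2 ∧ e ≠ 2 ∧ e ≠ 3 then -ψs
  else if ir = 1 ∧ js = 0 ∧ e = 2 then 4 * (yr ^ 2 + 3 * ys * ys1) * (ys * ψs + 1)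
  else if ir = 1 ∧ js = 1 ∧ e = 2 then
    ys1 * ψr * ψs * ψr - 3 * yr1 * ψs * ψr * ψs - yr ^ 2 + 3 * ys ^ 2
  else if ir = 0 ∧ js = 1 ∧ e = 3 then -(ψr * ψs * ψr)
  else if ir = 0 ∧ js = -1 ∧ e = 3 then ψr * ψs * ψr
  else 0

/-- `σ_r(y_s) = y_s - a_{sr} y_r`. -/
def reflY (A : FiniteCartanMatrix n) (y : Fin n → B) (r s : Fin n) : B :=
  y s - (A.a s r : B) * y r

/-- The KLR-type relations between elements `y_r`, `ψ_r`, `ε(i)` of a ring. -/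
inductive Rel (A : FiniteCartanMatrix n) (C : Finset (Fin n → ZMod e))
    (y ψ : Fin n → B) (ε : C → B) : B → B → Prop
  | eps_idem (i : C) : Rel A C y ψ ε (ε i * ε i) (ε i)
  | eps_orth (i j : C) (h : i ≠ j) : Rel A C y ψ ε (ε i * ε j) 0
  | eps_sum : Rel A C y ψ ε (∑ i : C, ε i) 1
  | y_eps (r : Fin n) (i : C) : Rel A C y ψ ε (y r * ε i) (ε i * y r)
  | y_comm (r s : Fin n) : Rel A C y ψ ε (y r * y s) (y s * y r)
  | psi_eps (r : Fin n) (i j : C) (h : j.1 = A.reflection e r i.1) :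
      Rel A C y ψ ε (ψ r * ε i) (ε j * ψ r)
  /- The divided difference `∂_r(y_s) = (σ_r(y_s) - y_s) / y_r` is the constant `-a_{sr}`. -/
  | psi_y (r s : Fin n) (i : C) :
      Rel A C y ψ ε (ψ r * y s * ε i)
        ((reflY A y r s * ψ r + if i.1 r = 0 then -(A.a s r : B) else 0) * ε i)
  | psi_sq (r : Fin n) (i : C) :
      Rel A C y ψ ε (ψ r ^ 2 * ε i) (squareTerm (i.1 r) (y r) * ε i)
  | psi_comm (r s : Fin n) (h : A.a r s = 0) : Rel A C y ψ ε (ψ r * ψ s) (ψ s * ψ r)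
  | braid3 (r s : Fin n) (h : A.a r s = -1) (h' : A.a s r = -1) (i : C) :
      Rel A C y ψ ε ((ψ r * ψ s * ψ r - ψ s * ψ r * ψ s) * ε i)
        (braidTerm3 (i.1 r) (i.1 s) (y r) (y s) * ε i)
  | braid4 (r s : Fin n) (h : A.a r s = -2) (i : C) :
      Rel A C y ψ ε (((ψ r * ψ s) ^ 2 - (ψ s * ψ r) ^ 2) * ε i)
        (braidTerm4 (i.1 r) (i.1 s) (y r) (y s) (ψ r) (ψ s) * ε i)
  | braid6 (r s : Fin n) (h : A.a r s = -3) (i : C) :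
      Rel A C y ψ ε (((ψ r * ψ s) ^ 3 - (ψ s * ψ r) ^ 3) * ε i)
        (braidTerm6 (i.1 r) (i.1 s) (y r) (y s) (reflY A y s r) (reflY A y r s) (ψ r) (ψ s)
          * ε i)

/-- The value `f(y)` of a polynomial at a tuple of elements of a `k`-algebra, with the factors of
each monomial in increasing order (the order is immaterial where the `y_r` commute). -/
noncomputable def polyEval {k : Type*} [Field k] [Algebra k B] (y : Fin n → B)
    (f : MvPolynomial (Fin n) k) : B :=
  ∑ m ∈ f.support, f.coeff m • (List.ofFn fun r => y r ^ m r).prod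

/-- The KLR-type relations, together with `f f⁻¹ = f⁻¹ f = 1` for the polynomials `f` in the `y_r`
with `f(0) ≠ 0`. -/
inductive BKRel {k : Type*} [Field k] [Algebra k B] (A : FiniteCartanMatrix n)
    (C : Finset (Fin n → ZMod e)) (y ψ : Fin n → B) (ε : C → B)
    (inv : {f : MvPolynomial (Fin n) k // MvPolynomial.constantCoeff f ≠ 0} → B) :
    B → B → Prop
  | klr (u v : B) (h : Rel A C y ψ ε u v) : BKRel A C y ψ ε inv u v
  | mul_inv (f : {f : MvPolynomial (Fin n) k // MvPolynomial.constantCoeff f ≠ 0}) :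
      BKRel A C y ψ ε inv (polyEval y f.1 * inv f) 1
  | inv_mul (f : {f : MvPolynomial (Fin n) k // MvPolynomial.constantCoeff f ≠ 0}) :
      BKRel A C y ψ ε inv (inv f * polyEval y f.1) 1

end Relations

/-- The generators of the polynomial KLR-type algebra. -/
inductive Gen (C : Finset (Fin n → ZMod e)) : Type
  | y (r : Fin n)
  | psi (r : Fin n)
  | eps (i : C)

/-- The generators of the BK subalgebra. -/
inductive BKGen (k : Type*) [Field k] (C : Finset (Fin n → ZMod e))
  | y (r : Fin n)
  | psi (r : Fin n)
  | eps (i : C)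
  | inv (f : {f : MvPolynomial (Fin n) k // MvPolynomial.constantCoeff f ≠ 0})

section Algebras

variable (k : Type*) [Field k] (A : FiniteCartanMatrix n) (C : Finset (Fin n → ZMod e))

/-- The polynomial KLR-type algebra `R`. -/
abbrev PolyAlgebra : Type _ :=
  RingQuot (Rel A C
    (fun r => FreeAlgebra.ι k (Gen.y (C := C) r))
    (fun r => FreeAlgebra.ι k (Gen.psi (C := C) r))
    (fun i => FreeAlgebra.ι k (Gen.eps i)))

/-- The class of a generator in `R`. -/
noncomputable def PolyAlgebra.gen (g : Gen C) : PolyAlgebra k A C :=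
  RingQuot.mkAlgHom k _ (FreeAlgebra.ι k g)

/-- The BK subalgebra `L̃`. -/
abbrev BKAlgebra : Type _ :=
  RingQuot (BKRel (k := k) A C
    (fun r => FreeAlgebra.ι k (BKGen.y (k := k) (C := C) r))
    (fun r => FreeAlgebra.ι k (BKGen.psi (k := k) (C := C) r))
    (fun i => FreeAlgebra.ι k (BKGen.eps (k := k) i))
    (fun f => FreeAlgebra.ι k (BKGen.inv (C := C) f)))

/-- The class of a generator in `L̃`. -/
noncomputable def BKAlgebra.gen (g : BKGen k C) : BKAlgebra k A C :=
  RingQuot.mkAlgHom k _ (FreeAlgebra.ι k g)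

/-- The relations `y_1 ^ Λ_{i_1} ε(i) = 0` for `i ∈ C`. -/
inductive CyclotomicRel [NeZero n] {B : Type*} [Ring B] (C : Finset (Fin n → ZMod e))
    (Λ : ZMod e →₀ ℕ) (y : Fin n → B) (ε : C → B) : B → B → Prop
  | mk (i : C) : CyclotomicRel C Λ y ε (y 0 ^ Λ (i.1 0) * ε i) 0

variable [NeZero n] (Λ : ZMod e →₀ ℕ)

/-- `R(Λ)`, the quotient of `R` by the two-sided ideal generated by the `y_1 ^ Λ_{i_1} ε(i)`. -/
abbrev CyclotomicPolyAlgebra : Type _ :=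
  RingQuot (CyclotomicRel C Λ
    (fun r => PolyAlgebra.gen k A C (Gen.y r)) (fun i => PolyAlgebra.gen k A C (Gen.eps i)))

/-- The class of a generator of `R` in `R(Λ)`. -/
noncomputable def CyclotomicPolyAlgebra.gen (g : Gen C) : CyclotomicPolyAlgebra k A C Λ :=
  RingQuot.mkAlgHom k _ (PolyAlgebra.gen k A C g)

/-- `L̃(Λ)`, the quotient of `L̃` by the two-sided ideal generated by the
`y_1 ^ Λ_{i_1} ε(i)`. -/
abbrev CyclotomicBKAlgebra : Type _ :=
  RingQuot (CyclotomicRel C Λ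
    (fun r => BKAlgebra.gen k A C (BKGen.y r)) (fun i => BKAlgebra.gen k A C (BKGen.eps i)))

/-- The class of a generator of `L̃` in `L̃(Λ)`. -/
noncomputable def CyclotomicBKAlgebra.gen (g : BKGen k C) : CyclotomicBKAlgebra k A C Λ :=
  RingQuot.mkAlgHom k _ (BKAlgebra.gen k A C g)

end Algebras

end KLRType

/-!
In a cyclotomic quotient every `y_r` is nilpotent. The defining relation of the quotient says this
for the vertex 1, and nilpotency spreads along the paths from the vertex 1
(`KLRType.isNilpotent_y_of_ne_zero`): let `a_{rs} ≠ 0` in the field, let `y_r ^ N = 0`, and put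
`z = σ_s(y_r) = y_r - a_{rs} y_s`.
* If `i_s ≠ 0`, then `ψ_s` intertwines `y_r` and `z`, so
  `0 = ψ_s y_r ^ N ψ_s ε(i) = z ^ N ψ_s ^ 2 ε(i) = ± z ^ N y_s ^ m ε(i)` for some `m`.
* If `i_s = 0`, then `ψ_s ε(i)` satisfies the nil-Hecke relations. Let `h` be the quotient of
  `z ^ N - y_r ^ N` by `z - y_r`. Moving `ψ_s` past `y_r ^ N = 0` gives
  `(z ^ N ψ_s - a_{rs} h) ε(i) = 0`; multiplying by `ψ_s` yields `h ψ_s ε(i) = 0`, commuting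
  `y_r` past this yields `h ε(i) = 0`, and hence `z ^ N ε(i) = 0`.

In both cases `z y_s ε(i)` is nilpotent, and so is `a_{rs} y_s ^ 2 ε(i) = (y_r - z) y_s ε(i)`.

A polynomial with nonzero constant term is therefore already invertible in `R(Λ)`
(`KLRType.isUnit_polyEval`), so that the universal properties of `R(Λ)` and `L̃(Λ)` provide
mutually inverse homomorphisms. The braid relations only have to be carried along.
-/

namespace KLRType

/-! ### Transporting the relations along homomorphisms -/

section Transport

variable {n e : ℕ} {B B' : Type*} [Ring B] [Ring B']

theorem map_squareTerm (f : B →+* B') (i : ZMod e) (y : B) :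
    f (squareTerm i y) = squareTerm i (f y) := by
  unfold squareTerm
  split_ifs <;> simp

theorem map_braidTerm3 (f : B →+* B') (i j : ZMod e) (y y' : B) :
    f (braidTerm3 i j y y') = braidTerm3 i j (f y) (f y') := by
  unfold braidTerm3
  split_ifs <;> simp

theorem map_braidTerm4 (f : B →+* B') (i j : ZMod e) (y y' ψ ψ' : B) :
    f (braidTerm4 i j y y' ψ ψ') = braidTerm4 i j (f y) (f y') (f ψ) (f ψ') := by
  simp only [braidTerm4, apply_ite f, map_mul, map_add, map_neg, map_one, map_zero, map_ofNat]

theorem map_braidTerm6 (f : B →+* B') (i j : ZMod e) (y y' y1 y1' ψ ψ' : B) :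
    f (braidTerm6 i j y y' y1 y1' ψ ψ') =
      braidTerm6 i j (f y) (f y') (f y1) (f y1') (f ψ) (f ψ') := by
  simp only [braidTerm6, apply_ite f, map_mul, map_add, map_sub, map_neg, map_pow, map_one,
    map_zero, map_ofNat]

theorem map_reflY (f : B →+* B') (A : FiniteCartanMatrix n) (y : Fin n → B) (r s : Fin n) :
    f (reflY A y r s) = reflY A (fun t => f (y t)) r s := by
  simp [reflY]

theorem map_polyEval {k : Type*} [Field k] [Algebra k B] [Algebra k B'] (f : B →ₐ[k] B')
    (y : Fin n → B) (p : MvPolynomial (Fin n) k) :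
    f (polyEval y p) = polyEval (fun r => f (y r)) p := by
  simp [polyEval, map_list_prod, List.map_ofFn, Function.comp_def]

theorem Rel.map {A : FiniteCartanMatrix n} {C : Finset (Fin n → ZMod e)}
    {y ψ : Fin n → B} {ε : C → B} (f : B →+* B') {u v : B} (h : Rel A C y ψ ε u v) :
    Rel A C (fun r => f (y r)) (fun r => f (ψ r)) (fun i => f (ε i)) (f u) (f v) := by
  cases h with
  | eps_idem i => simpa using Rel.eps_idem i
  | eps_orth i j h => simpa using Rel.eps_orth i j h
  | eps_sum => simpa using Rel.eps_sum
  | y_eps r i => simpa using Rel.y_eps r i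
  | y_comm r s => simpa using Rel.y_comm r s
  | psi_eps r i j h => simpa using Rel.psi_eps r i j h
  | psi_y r s i =>
    simpa [map_reflY, apply_ite f] using Rel.psi_y (A := A) (y := fun r => f (y r))
      (ψ := fun r => f (ψ r)) (ε := fun i => f (ε i)) r s i
  | psi_sq r i => simpa [map_squareTerm] using Rel.psi_sq r i
  | psi_comm r s h => simpa using Rel.psi_comm r s h
  | braid3 r s h h' i => simpa [map_braidTerm3] using Rel.braid3 r s h h' i
  | braid4 r s h i => simpa [map_braidTerm4] using Rel.braid4 r s h i
  | braid6 r s h i => simpa [map_braidTerm6, map_reflY] using Rel.braid6 r s h i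

/-- Every relation between the images of a family is the image of a relation between the members
of the family. -/
theorem Rel.exists_of_map {A : FiniteCartanMatrix n} {C : Finset (Fin n → ZMod e)}
    {y ψ : Fin n → B} {ε : C → B} (f : B →+* B') {u v : B'}
    (h : Rel A C (fun r => f (y r)) (fun r => f (ψ r)) (fun i => f (ε i)) u v) :
    ∃ u' v', Rel A C y ψ ε u' v' ∧ f u' = u ∧ f v' = v := by
  cases h with
  | eps_idem i => exact ⟨_, _, .eps_idem i, by simp, by simp⟩
  | eps_orth i j h => exact ⟨_, _, .eps_orth i j h, by simp, by simp⟩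
  | eps_sum => exact ⟨_, _, .eps_sum, by simp, by simp⟩
  | y_eps r i => exact ⟨_, _, .y_eps r i, by simp, by simp⟩
  | y_comm r s => exact ⟨_, _, .y_comm r s, by simp, by simp⟩
  | psi_eps r i j h => exact ⟨_, _, .psi_eps r i j h, by simp, by simp⟩
  | psi_y r s i => exact ⟨_, _, .psi_y r s i, by simp, by simp [map_reflY, apply_ite f]⟩
  | psi_sq r i => exact ⟨_, _, .psi_sq r i, by simp, by simp [map_squareTerm]⟩
  | psi_comm r s h => exact ⟨_, _, .psi_comm r s h, by simp, by simp⟩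
  | braid3 r s h h' i => exact ⟨_, _, .braid3 r s h h' i, by simp, by simp [map_braidTerm3]⟩
  | braid4 r s h i => exact ⟨_, _, .braid4 r s h i, by simp, by simp [map_braidTerm4]⟩
  | braid6 r s h i =>
    exact ⟨_, _, .braid6 r s h i, by simp, by simp [map_braidTerm6, map_reflY]⟩

end Transport

/-! ### Nilpotency of the polynomial generators -/

section Nilpotency

variable {n e : ℕ} {B : Type*} [Ring B]

theorem squareTerm_eq_pow {i : ZMod e} (hi : i ≠ 0) (y : B) :
    ∃ m : ℕ, squareTerm i y = y ^ m ∨ squareTerm i y = -y ^ m := by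
  unfold squareTerm
  rw [if_neg hi]
  split_ifs
  · exact ⟨1, by simp⟩
  · exact ⟨1, by simp⟩
  · exact ⟨2, by simp⟩
  · exact ⟨0, by simp⟩

/-- If `p` intertwines `x` and `z` up to the scalar `a`, then it intertwines `x ^ m` and `z ^ m`
up to `a * h`, where `h` is the divided difference `(z ^ m - x ^ m) / (z - x)`. -/
theorem exists_dividedDifference {x z p a ε : B} (hxz : Commute x z) (hxε : Commute x ε)
    (ha : ∀ b : B, Commute a b) (hp : p * x * ε = (z * p - a) * ε) (m : ℕ) :
    ∃ h : B, Commute h z ∧ p * x ^ m * ε = (z ^ m * p - a * h) * ε ∧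
      (z - x) * h = z ^ m - x ^ m := by
  induction m with
  | zero => exact ⟨0, by simp, by simp, by simp⟩
  | succ m ih =>
    obtain ⟨h, hz, h1, h2⟩ := ih
    refine ⟨z ^ m + h * x, ?_, ?_, ?_⟩
    · exact ((Commute.refl z).pow_left m).add_left (hz.mul_left hxz)
    · calc p * x ^ (m + 1) * ε = p * x ^ m * ε * x := by
            rw [pow_succ, mul_assoc, mul_assoc, hxε.eq]; noncomm_ring
        _ = z ^ m * (p * x * ε) - a * (h * x) * ε := by
            rw [h1, mul_assoc, ← hxε.eq]; noncomm_ring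
        _ = (z ^ (m + 1) * p - a * (z ^ m + h * x)) * ε := by
            rw [hp, pow_succ, mul_add, (ha (z ^ m)).eq]; noncomm_ring
    · calc (z - x) * (z ^ m + h * x) = z * z ^ m - x * z ^ m + (z - x) * h * x := by noncomm_ring
        _ = z * z ^ m - z ^ m * x + (z ^ m - x ^ m) * x := by
            rw [h2, (hxz.pow_right m).eq]
        _ = z ^ (m + 1) - x ^ (m + 1) := by
            rw [pow_succ' z, pow_succ x]; noncomm_ring

/-- The nil-Hecke case: if moreover `p ^ 2 = 0` and `a` is cancellable, nilpotency passes from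
`x` to `z`. -/
theorem pow_mul_eq_zero_of_sq_eq_zero {x z p a ε : B} (hxz : Commute x z) (hxε : Commute x ε)
    (ha : ∀ b : B, Commute a b) (ha0 : ∀ b : B, a * b = 0 → b = 0)
    (hpε : Commute p ε) (hp : p * x * ε = (z * p - a) * ε) (hsq : p ^ 2 * ε = 0)
    {N : ℕ} (hN : x ^ N = 0) : z ^ N * ε = 0 := by
  obtain ⟨h, hz, h1, h2⟩ := exists_dividedDifference hxz hxε ha hp N
  have e1 : (z ^ N * p - a * h) * ε = 0 := by rw [← h1, hN]; simp
  have e2 : h * p * ε = 0 := by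
    apply ha0
    calc a * (h * p * ε) = z ^ N * (p ^ 2 * ε) - (z ^ N * p - a * h) * ε * p := by
          rw [mul_assoc _ ε p, ← hpε.eq]; noncomm_ring
      _ = 0 := by rw [e1, hsq]; simp
  have e3 : h * ε = 0 := by
    apply ha0
    calc a * (h * ε) = h * (a * ε) := by rw [← mul_assoc, (ha h).eq, mul_assoc]
      _ = h * z * p * ε - h * ((z * p - a) * ε) := by noncomm_ring
      _ = z * (h * p * ε) - h * p * ε * x := by
          rw [← hp, hz.eq, mul_assoc (h * p) ε x, ← hxε.eq]; noncomm_ring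
      _ = 0 := by rw [e2]; simp
  calc z ^ N * ε = (z ^ N - x ^ N) * ε := by rw [hN, sub_zero]
    _ = 0 := by rw [← h2, mul_assoc, e3, mul_zero]

/-- The core of the argument: nilpotency of `y_r` passes to `y_s` along an arrow with
`a_{rs} ≠ 0` in the ground field, by means of the commutation of `ψ_s` with `y_r`. -/
theorem isNilpotent_y_of_ne_zero {k : Type*} [Field k] [Algebra k B] {A : FiniteCartanMatrix n}
    {C : Finset (Fin n → ZMod e)} (hC : ∀ r, ∀ i ∈ C, A.reflection e r i ∈ C)
    {y ψ : Fin n → B} {ε : C → B} (hrel : ∀ u v, Rel A C y ψ ε u v → u = v)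
    {r s : Fin n} (hrs : ((A.a r s : ℤ) : k) ≠ 0) (hr : IsNilpotent (y r)) :
    IsNilpotent (y s) := by
  have hyy (r s) : Commute (y r) (y s) := hrel _ _ (.y_comm r s)
  have hyε (r i) : Commute (y r) (ε i) := hrel _ _ (.y_eps r i)
  have hεε (i) : ε i * ε i = ε i := hrel _ _ (.eps_idem i)
  have ha (b : B) : Commute ((A.a r s : ℤ) : B) b := Int.cast_commute _ _
  have ha0 (b : B) (hb : ((A.a r s : ℤ) : B) * b = 0) : b = 0 := by
    rw [← map_intCast (algebraMap k B), ← Algebra.smul_def] at hb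
    exact (smul_eq_zero_iff_right hrs).1 hb
  obtain ⟨N, hN⟩ := hr
  set z : B := y r - (A.a r s : B) * y s with hz
  have hxz : Commute (y r) z :=
    (Commute.refl _).sub_right ((ha _).symm.mul_right (hyy r s))
  have hzy : Commute z (y s) := (hyy r s).sub_left ((ha _).mul_left (Commute.refl _))
  have hzε (i) : Commute z (ε i) := (hyε r i).sub_left ((ha _).mul_left (hyε s i))
  have key (i : C) : ∃ m : ℕ, z ^ N * y s ^ m * ε i = 0 := by
    by_cases hi : i.1 s = 0
    · refine ⟨0, ?_⟩
      have hfix : i.1 = A.reflection e s i.1 := by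
        funext t
        change i.1 t = i.1 t - _ * i.1 s
        rw [hi, mul_zero, sub_zero]
      have h1 := hrel _ _ (.psi_y s r i)
      have h2 := hrel _ _ (.psi_sq s i)
      rw [if_pos hi, ← sub_eq_add_neg] at h1
      rw [squareTerm, if_pos hi, zero_mul] at h2
      rw [pow_zero, mul_one]
      exact pow_mul_eq_zero_of_sq_eq_zero hxz (hyε r i) ha ha0
        (hrel _ _ (.psi_eps s i i hfix)) h1 h2 hN
    · let j : C := ⟨A.reflection e s i.1, hC s _ i.2⟩
      have hj : j.1 s ≠ 0 := by
        change i.1 s - (A.a s s : ZMod e) * i.1 s ≠ 0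
        rw [A.diag s]
        intro h
        apply hi
        have : -(i.1 s) = 0 := by rw [← h]; push_cast; ring
        simpa using this
      have h1 : ψ s * y r * ε j = (z * ψ s - 0) * ε j := by
        have := hrel _ _ (.psi_y s r j)
        rwa [if_neg hj, add_zero, ← sub_zero (_ * ψ s)] at this
      -- There is no error term here, so the intertwining is exact: `a = 0`.
      obtain ⟨h, -, h2, -⟩ := exists_dividedDifference hxz (hyε r j)
        (fun b => Commute.zero_left b) h1 N
      have h3 : ψ s * ε i = ε j * ψ s := hrel _ _ (.psi_eps s i j rfl)
      have h4 := hrel _ _ (.psi_sq s i)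
      have h5 : z ^ N * (squareTerm (i.1 s) (y s) * ε i) = 0 := by
        calc z ^ N * (squareTerm (i.1 s) (y s) * ε i)
            = z ^ N * ψ s * (ψ s * ε i) := by rw [← h4]; noncomm_ring
          _ = (z ^ N * ψ s - 0 * h) * ε j * ψ s := by rw [h3]; noncomm_ring
          _ = 0 := by rw [← h2, hN]; simp
      obtain ⟨m, hm | hm⟩ := squareTerm_eq_pow hi (y s)
      · exact ⟨m, by rw [← h5, hm, mul_assoc]⟩
      · exact ⟨m, by rw [← neg_eq_zero, ← h5, hm]; noncomm_ring⟩
  have hnil (i : C) : IsNilpotent (y s * ε i) := by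
    obtain ⟨m, hm⟩ := key i
    have hzyε : Commute (z * y s) (ε i) := (hzε i).mul_left (hyε s i)
    have hxyε : Commute (y r * y s) (ε i) := (hyε r i).mul_left (hyε s i)
    have h1 : IsNilpotent (z * y s * ε i) := by
      -- The extra factor keeps the exponent positive, as `ε(i) ^ 0 = 1`.
      refine ⟨N + m + 1, ?_⟩
      rw [hzyε.mul_pow, hzy.mul_pow, IsIdempotentElem.pow_succ_eq _ (hεε i)]
      calc z ^ (N + m + 1) * y s ^ (N + m + 1) * ε i
          = z ^ (m + 1) * (z ^ N * y s ^ (N + 1) * y s ^ m) * ε i := by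
            rw [show N + m + 1 = (m + 1) + N by ring, pow_add z,
              show (m + 1) + N = (N + 1) + m by ring, pow_add (y s)]
            noncomm_ring
        _ = z ^ (m + 1) * y s ^ (N + 1) * (z ^ N * y s ^ m * ε i) := by
            rw [(hzy.pow_pow N (N + 1)).eq]; noncomm_ring
        _ = 0 := by rw [hm, mul_zero]
    have h2 : IsNilpotent (y r * y s * ε i) := by
      rw [mul_assoc]
      exact ((hyy r s).mul_right (hyε r i)).isNilpotent_mul_right ⟨N, hN⟩
    have hc : Commute (y r * y s * ε i) (z * y s * ε i) := by
      refine Commute.mul_right (Commute.mul_left ?_ hzyε.symm)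
        (hxyε.mul_left (Commute.refl _))
      exact (hxz.mul_right (hyy r s)).mul_left (hzy.symm.mul_right (Commute.refl _))
    -- `a_{rs} y_s² = y_r y_s - σ_s(y_r) y_s`
    obtain ⟨M, hM⟩ := hc.isNilpotent_sub h2 h1
    have h3 : y r * y s * ε i - z * y s * ε i =
        (A.a r s : B) * (y s * ε i) ^ 2 := by
      rw [(hyε s i).mul_pow, pow_two (ε i), hεε, hz]; noncomm_ring
    rw [h3, (ha _).mul_pow] at hM
    have h4 : ∀ (M : ℕ) (b : B), ((A.a r s : ℤ) : B) ^ M * b = 0 → b = 0 := by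
      intro M
      induction M with
      | zero => simp
      | succ M ih =>
        intro b hb
        rw [pow_succ, mul_assoc] at hb
        exact ha0 b (ih _ hb)
    exact ⟨2 * M, by rw [pow_mul]; exact h4 M _ hM⟩
  have hsum : ∑ i : C, y s * ε i = y s := by
    rw [← Finset.mul_sum, hrel _ _ .eps_sum, mul_one]
  rw [← hsum]
  refine Commute.isNilpotent_sum (fun i _ => hnil i) fun i j _ _ => ?_
  by_cases hij : i = j
  · rw [hij]
  · refine Commute.mul_right ((Commute.refl _).mul_left (hyε s i).symm) ((hyε s j).mul_left ?_)
    exact (hrel _ _ (.eps_orth i j hij)).trans (hrel _ _ (.eps_orth j i (Ne.symm hij))).symm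

theorem polyEval_eq_aeval {k S : Type*} [Field k] [CommRing S] [Algebra k S] (y : Fin n → S)
    (f : MvPolynomial (Fin n) k) : polyEval y f = MvPolynomial.aeval y f := by
  rw [MvPolynomial.aeval_def, MvPolynomial.eval₂_eq']
  simp [polyEval, List.prod_ofFn, Algebra.smul_def]

open scoped IsMulCommutative in
/-- A polynomial with nonzero constant term is a unit at commuting nilpotent elements. -/
theorem isUnit_polyEval {k : Type*} [Field k] [Algebra k B] {y : Fin n → B}
    (hcomm : ∀ r s, Commute (y r) (y s)) (hnil : ∀ r, IsNilpotent (y r))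
    {f : MvPolynomial (Fin n) k} (hf : MvPolynomial.constantCoeff f ≠ 0) :
    IsUnit (polyEval y f) := by
  let S := Algebra.adjoin k (Set.range y)
  have : IsMulCommutative S := Algebra.isMulCommutative_adjoin k (by
    rintro _ ⟨r, rfl⟩ _ ⟨s, rfl⟩; exact hcomm r s)
  let y' (r : Fin n) : S := ⟨y r, Algebra.subset_adjoin ⟨r, rfl⟩⟩
  -- Modulo the nilradical of the commutative algebra `k[y]`, `f(y)` is the scalar `f(0)`.
  have hquot : (Ideal.Quotient.mkₐ k (nilradical S)).comp (MvPolynomial.aeval y') =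
      (Algebra.ofId k _).comp (MvPolynomial.aeval (0 : Fin n → k)) := by
    ext r
    have : y' r ∈ nilradical S := by
      obtain ⟨N, hN⟩ := hnil r
      exact ⟨N, Subtype.ext hN⟩
    simpa using Ideal.Quotient.eq_zero_iff_mem.2 this
  have hmem : MvPolynomial.aeval y' f - algebraMap k S (MvPolynomial.constantCoeff f) ∈
      nilradical S := by
    rw [← Ideal.Quotient.eq_zero_iff_mem, map_sub, sub_eq_zero]
    simpa using DFunLike.congr_fun hquot f
  have hunit : IsUnit (MvPolynomial.aeval y' f) := by
    rw [← sub_add_cancel (MvPolynomial.aeval y' f)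
      (algebraMap k S (MvPolynomial.constantCoeff f))]
    exact IsNilpotent.isUnit_add_right_of_commute hmem ((IsUnit.mk0 _ hf).map _)
      (Commute.all _ _)
  have heval : polyEval y f = S.val (MvPolynomial.aeval y' f) := by
    rw [← polyEval_eq_aeval, map_polyEval]
    rfl
  rw [heval]
  exact hunit.map _

end Nilpotency

/-! ### The cyclotomic quotients -/

section Cyclotomic

variable {n e : ℕ} {k : Type*} [Field k] {A : FiniteCartanMatrix n}
  {C : Finset (Fin n → ZMod e)}

theorem reflection_mem_of_eq_orbit {i : Fin n → ZMod e}
    (hC : (C : Set (Fin n → ZMod e)) = MulAction.orbit (A.weylGroup e) i) (r : Fin n)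
    (j : Fin n → ZMod e) (hj : j ∈ C) : A.reflection e r j ∈ C := by
  rw [← Finset.mem_coe, hC] at hj ⊢
  exact (MulAction.smul_orbit_subset
    (⟨A.reflection e r, Subgroup.subset_closure ⟨r, rfl⟩⟩ : A.weylGroup e) i)
    (Set.smul_mem_smul_set hj)

variable [NeZero n] {Λ : ZMod e →₀ ℕ}

theorem isNilpotent_y_zero {B : Type*} [Ring B] {y ψ : Fin n → B} {ε : C → B}
    (hrel : ∀ u v, Rel A C y ψ ε u v → u = v)
    (hcyc : ∀ u v, CyclotomicRel C Λ y ε u v → u = v) : IsNilpotent (y 0) := by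
  refine ⟨∑ i : C, Λ (i.1 0), ?_⟩
  rw [← mul_one (y 0 ^ _), ← hrel _ _ .eps_sum, Finset.mul_sum]
  refine Finset.sum_eq_zero fun i _ => ?_
  rw [← Finset.sum_erase_add _ _ (Finset.mem_univ i), pow_add, mul_assoc, hcyc _ _ (.mk i),
    mul_zero]

theorem isNilpotent_y {B : Type*} [Ring B] [Algebra k B] {y ψ : Fin n → B} {ε : C → B}
    (hpath : ∀ s : Fin n, Relation.ReflTransGen (fun r t : Fin n => ((A.a r t : ℤ) : k) ≠ 0) 0 s)
    (hC : ∀ r, ∀ i ∈ C, A.reflection e r i ∈ C)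
    (hrel : ∀ u v, Rel A C y ψ ε u v → u = v)
    (hcyc : ∀ u v, CyclotomicRel C Λ y ε u v → u = v) (s : Fin n) : IsNilpotent (y s) := by
  induction hpath s with
  | refl => exact isNilpotent_y_zero hrel hcyc
  | tail _ h ih => exact isNilpotent_y_of_ne_zero hC hrel h ih

variable (k A C Λ) in
/-- The presentation of `R(Λ)` as a quotient of a free algebra. -/
noncomputable def CyclotomicPolyAlgebra.ofFree :
    FreeAlgebra k (Gen C) →ₐ[k] CyclotomicPolyAlgebra k A C Λ :=
  AlgHom.comp (B := PolyAlgebra k A C) (RingQuot.mkAlgHom k _) (RingQuot.mkAlgHom k _)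

theorem CyclotomicPolyAlgebra.eq_of_rel {u v : CyclotomicPolyAlgebra k A C Λ}
    (h : Rel A C (fun r => gen k A C Λ (.y r)) (fun r => gen k A C Λ (.psi r))
      (fun i => gen k A C Λ (.eps i)) u v) : u = v := by
  obtain ⟨u', v', h', rfl, rfl⟩ := Rel.exists_of_map (B' := CyclotomicPolyAlgebra k A C Λ)
    (y := fun r => FreeAlgebra.ι k (Gen.y (C := C) r))
    (ψ := fun r => FreeAlgebra.ι k (Gen.psi (C := C) r))
    (ε := fun i => FreeAlgebra.ι k (Gen.eps i)) (ofFree k A C Λ).toRingHom h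
  exact congrArg (RingQuot.mkAlgHom k _)
    (RingQuot.mkAlgHom_rel k h')

theorem CyclotomicPolyAlgebra.eq_of_cyclotomicRel {u v : CyclotomicPolyAlgebra k A C Λ}
    (h : CyclotomicRel C Λ (fun r => gen k A C Λ (.y r)) (fun i => gen k A C Λ (.eps i)) u v) :
    u = v := by
  obtain ⟨i⟩ := h
  simpa [gen] using RingQuot.mkAlgHom_rel k (CyclotomicRel.mk (Λ := Λ)
    (y := fun r => PolyAlgebra.gen k A C (.y r)) (ε := fun i => PolyAlgebra.gen k A C (.eps i)) i)

/-- The universal property of `R(Λ)`. -/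
theorem CyclotomicPolyAlgebra.exists_lift {B : Type*} [Ring B] [Algebra k B] (g : Gen C → B)
    (hrel : ∀ u v, Rel A C (fun r => g (.y r)) (fun r => g (.psi r)) (fun i => g (.eps i)) u v →
      u = v)
    (hcyc : ∀ u v, CyclotomicRel C Λ (fun r => g (.y r)) (fun i => g (.eps i)) u v → u = v) :
    ∃ φ : CyclotomicPolyAlgebra k A C Λ →ₐ[k] B, ∀ x, φ (gen k A C Λ x) = g x := by
  let φ₀ : PolyAlgebra k A C →ₐ[k] B := RingQuot.liftAlgHom k ⟨FreeAlgebra.lift k g, by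
    intro u v h
    have := h.map (FreeAlgebra.lift k g).toRingHom
    exact hrel _ _ (by simpa using this)⟩
  have hφ₀ (x) : φ₀ (PolyAlgebra.gen k A C x) = g x := by
    simp [φ₀, PolyAlgebra.gen]
  refine ⟨RingQuot.liftAlgHom k ⟨φ₀, ?_⟩, fun x => ?_⟩
  · rintro _ _ ⟨i⟩
    simpa [hφ₀] using hcyc _ _ (.mk i)
  · rw [gen, RingQuot.liftAlgHom_mkAlgHom_apply, hφ₀]

theorem CyclotomicPolyAlgebra.algHom_ext {B : Type*} [Semiring B] [Algebra k B]
    {φ φ' : CyclotomicPolyAlgebra k A C Λ →ₐ[k] B}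
    (h : ∀ x, φ (gen k A C Λ x) = φ' (gen k A C Λ x)) : φ = φ' := by
  apply RingQuot.ringQuot_ext'
  apply RingQuot.ringQuot_ext'
  ext x
  exact h x

variable (k A C Λ) in
/-- The presentation of `L̃(Λ)` as a quotient of a free algebra. -/
noncomputable def CyclotomicBKAlgebra.ofFree :
    FreeAlgebra k (BKGen k C) →ₐ[k] CyclotomicBKAlgebra k A C Λ :=
  AlgHom.comp (B := BKAlgebra k A C) (RingQuot.mkAlgHom k _) (RingQuot.mkAlgHom k _)

theorem CyclotomicBKAlgebra.eq_of_rel {u v : CyclotomicBKAlgebra k A C Λ}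
    (h : Rel A C (fun r => gen k A C Λ (.y r)) (fun r => gen k A C Λ (.psi r))
      (fun i => gen k A C Λ (.eps i)) u v) : u = v := by
  obtain ⟨u', v', h', rfl, rfl⟩ := Rel.exists_of_map (B' := CyclotomicBKAlgebra k A C Λ)
    (y := fun r => FreeAlgebra.ι k (BKGen.y (k := k) (C := C) r))
    (ψ := fun r => FreeAlgebra.ι k (BKGen.psi (k := k) (C := C) r))
    (ε := fun i => FreeAlgebra.ι k (BKGen.eps (k := k) i)) (ofFree k A C Λ).toRingHom h
  exact congrArg (RingQuot.mkAlgHom k _)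
    (RingQuot.mkAlgHom_rel k (BKRel.klr _ _ h'))

theorem CyclotomicBKAlgebra.eq_of_cyclotomicRel {u v : CyclotomicBKAlgebra k A C Λ}
    (h : CyclotomicRel C Λ (fun r => gen k A C Λ (.y r)) (fun i => gen k A C Λ (.eps i)) u v) :
    u = v := by
  obtain ⟨i⟩ := h
  simpa [gen] using RingQuot.mkAlgHom_rel k (CyclotomicRel.mk (Λ := Λ)
    (y := fun r => BKAlgebra.gen k A C (.y r)) (ε := fun i => BKAlgebra.gen k A C (.eps i)) i)

theorem CyclotomicBKAlgebra.polyEval_mul_gen_inv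
    (f : {f : MvPolynomial (Fin n) k // MvPolynomial.constantCoeff f ≠ 0}) :
    polyEval (fun r => gen k A C Λ (.y r)) f.1 * gen k A C Λ (.inv f) = 1 := by
  have h : ofFree k A C Λ (_ * _) = ofFree k A C Λ 1 :=
    congrArg (RingQuot.mkAlgHom k _) (RingQuot.mkAlgHom_rel k (BKRel.mul_inv f))
  rw [map_mul, map_one, map_polyEval (B' := CyclotomicBKAlgebra k A C Λ)] at h
  exact h

/-- The universal property of `L̃(Λ)`. -/
theorem CyclotomicBKAlgebra.exists_lift {B : Type*} [Ring B] [Algebra k B] (g : BKGen k C → B)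
    (hrel : ∀ u v, Rel A C (fun r => g (.y r)) (fun r => g (.psi r)) (fun i => g (.eps i)) u v →
      u = v)
    (hmul : ∀ f, polyEval (fun r => g (.y r)) f.1 * g (.inv f) = 1)
    (hmul' : ∀ f, g (.inv f) * polyEval (fun r => g (.y r)) f.1 = 1)
    (hcyc : ∀ u v, CyclotomicRel C Λ (fun r => g (.y r)) (fun i => g (.eps i)) u v → u = v) :
    ∃ φ : CyclotomicBKAlgebra k A C Λ →ₐ[k] B, ∀ x, φ (gen k A C Λ x) = g x := by
  let φ₀ : BKAlgebra k A C →ₐ[k] B := RingQuot.liftAlgHom k ⟨FreeAlgebra.lift k g, by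
    rintro u v (⟨_, _, h⟩ | f | f)
    · have := h.map (FreeAlgebra.lift k g).toRingHom
      exact hrel _ _ (by simpa using this)
    · simpa [map_polyEval] using hmul f
    · simpa [map_polyEval] using hmul' f⟩
  have hφ₀ (x) : φ₀ (BKAlgebra.gen k A C x) = g x := by
    simp [φ₀, BKAlgebra.gen]
  refine ⟨RingQuot.liftAlgHom k ⟨φ₀, ?_⟩, fun x => ?_⟩
  · rintro _ _ ⟨i⟩
    simpa [hφ₀] using hcyc _ _ (.mk i)
  · rw [gen, RingQuot.liftAlgHom_mkAlgHom_apply, hφ₀]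

theorem CyclotomicBKAlgebra.algHom_ext {B : Type*} [Semiring B] [Algebra k B]
    {φ φ' : CyclotomicBKAlgebra k A C Λ →ₐ[k] B}
    (h : ∀ x, φ (gen k A C Λ x) = φ' (gen k A C Λ x)) : φ = φ' := by
  apply RingQuot.ringQuot_ext'
  apply RingQuot.ringQuot_ext'
  ext x
  exact h x

end Cyclotomic

end KLRType

theorem proposition3 {n : ℕ} [NeZero n] (A : FiniteCartanMatrix n) (k : Type*) [Field k]
    (hpath : ∀ s : Fin n, Relation.ReflTransGen (fun r t : Fin n => ((A.a r t : ℤ) : k) ≠ 0) 0 s)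
    (e : ℕ) (he : e ≠ 1) (C : Finset (Fin n → ZMod e))
    (hC : ∃ i : Fin n → ZMod e, (C : Set (Fin n → ZMod e)) = MulAction.orbit (A.weylGroup e) i)
    (Λ : ZMod e →₀ ℕ) :
    ∃ φ : KLRType.CyclotomicPolyAlgebra k A C Λ ≃ₐ[k] KLRType.CyclotomicBKAlgebra k A C Λ,
      (∀ r : Fin n, φ (KLRType.CyclotomicPolyAlgebra.gen k A C Λ (KLRType.Gen.y r)) =
        KLRType.CyclotomicBKAlgebra.gen k A C Λ (KLRType.BKGen.y r)) ∧
      (∀ r : Fin n, φ (KLRType.CyclotomicPolyAlgebra.gen k A C Λ (KLRType.Gen.psi r)) =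
        KLRType.CyclotomicBKAlgebra.gen k A C Λ (KLRType.BKGen.psi r)) ∧
      (∀ i : C, φ (KLRType.CyclotomicPolyAlgebra.gen k A C Λ (KLRType.Gen.eps i)) =
        KLRType.CyclotomicBKAlgebra.gen k A C Λ (KLRType.BKGen.eps i)) := by
  obtain ⟨i, hC⟩ := hC
  have hnil := KLRType.isNilpotent_y (B := KLRType.CyclotomicPolyAlgebra k A C Λ) hpath
    (KLRType.reflection_mem_of_eq_orbit hC)
    (fun _ _ => KLRType.CyclotomicPolyAlgebra.eq_of_rel)
    (fun _ _ => KLRType.CyclotomicPolyAlgebra.eq_of_cyclotomicRel)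
  have hunit (f : {f : MvPolynomial (Fin n) k // MvPolynomial.constantCoeff f ≠ 0}) :=
    KLRType.isUnit_polyEval
      (fun r s => KLRType.CyclotomicPolyAlgebra.eq_of_rel (k := k) (A := A) (Λ := Λ)
        (.y_comm r s)) hnil f.2
  let g : KLRType.BKGen k C → KLRType.CyclotomicPolyAlgebra k A C Λ
    | .y r => KLRType.CyclotomicPolyAlgebra.gen k A C Λ (.y r)
    | .psi r => KLRType.CyclotomicPolyAlgebra.gen k A C Λ (.psi r)
    | .eps i => KLRType.CyclotomicPolyAlgebra.gen k A C Λ (.eps i)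
    | .inv f => Ring.inverse
        (KLRType.polyEval (fun r => KLRType.CyclotomicPolyAlgebra.gen k A C Λ (.y r)) f.1)
  let g' : KLRType.Gen C → KLRType.CyclotomicBKAlgebra k A C Λ
    | .y r => KLRType.CyclotomicBKAlgebra.gen k A C Λ (.y r)
    | .psi r => KLRType.CyclotomicBKAlgebra.gen k A C Λ (.psi r)
    | .eps i => KLRType.CyclotomicBKAlgebra.gen k A C Λ (.eps i)
  obtain ⟨φ, hφ⟩ := KLRType.CyclotomicPolyAlgebra.exists_lift (k := k) (A := A) (Λ := Λ) g'
    (fun _ _ => KLRType.CyclotomicBKAlgebra.eq_of_rel)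
    (fun _ _ => KLRType.CyclotomicBKAlgebra.eq_of_cyclotomicRel)
  obtain ⟨θ, hθ⟩ := KLRType.CyclotomicBKAlgebra.exists_lift (k := k) (A := A) (Λ := Λ) g
    (fun _ _ => KLRType.CyclotomicPolyAlgebra.eq_of_rel)
    (fun f => Ring.mul_inverse_cancel _ (hunit f))
    (fun f => Ring.inverse_mul_cancel _ (hunit f))
    (fun _ _ => KLRType.CyclotomicPolyAlgebra.eq_of_cyclotomicRel)
  refine ⟨AlgEquiv.ofAlgHom φ θ ?_ ?_, fun r => hφ _, fun r => hφ _, fun i => hφ _⟩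
  · refine KLRType.CyclotomicBKAlgebra.algHom_ext fun x => ?_
    rw [AlgHom.comp_apply, AlgHom.id_apply, hθ]
    cases x with
    | y r => exact hφ _
    | psi r => exact hφ _
    | eps i => exact hφ _
    | inv f =>
      -- Both sides are inverse to `f(y)`.
      refine left_inv_eq_right_inv ?_ (KLRType.CyclotomicBKAlgebra.polyEval_mul_gen_inv f)
      have h := congrArg φ (Ring.inverse_mul_cancel _ (hunit f))
      rw [map_mul, map_one, KLRType.map_polyEval (B := KLRType.CyclotomicPolyAlgebra k A C Λ)
        (B' := KLRType.CyclotomicBKAlgebra k A C Λ)] at h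
      simpa only [hφ] using h
  · refine KLRType.CyclotomicPolyAlgebra.algHom_ext fun x => ?_
    rw [AlgHom.comp_apply, AlgHom.id_apply, hφ]
    cases x <;> exact hθ _
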